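/- Let $n\in\mathbb{N}$ and $j\in\{1,\dots,n\}$. Let $\mathcal{K}^n$ be the class of nonempty, compact, convex subsets of $\mathbb{R}^n$; let $\dim(K)$ be the dimension of the affine hull of $K\in\mathcal{K}^n$, and for integers $k\ge 0$ put $\mathcal{K}^n_k=\{K\in\mathcal{K}^n:\dim(K)\ge k\}$. Let $\mathrm{Gr}(n,j)$ be the Grassmannian of all $j$-dimensional linear subspaces of $\mathbb{R}^n$, let $\nu_j$ be the rotation invariant (Haar) Borel probability measure on $\mathrm{Gr}(n,j)$, and let $K|H$ denote the orthogonal projection of $K$ into $H\in\mathrm{Gr}(n,j)$. For $K,L\in\mathcal{K}^n$ define the $j$th intrinsic volume metric by $$\delta_j(K,L)=\binom{n}{j}\frac{\mathrm{vol}_n(B_n)}{\mathrm{vol}_j(B_j)\,\mathrm{vol}_{n-j}(B_{n-j})}\int_{\mathrm{Gr}(n,j)}\mathrm{vol}_j\big((K|H)\,\triangle\,(L|H)\big)\,\mathrm{d}\nu_j(H),$$ where $B_m$ is the Euclidean unit ball of $\mathbb{R}^m$, $\mathrm{vol}_j$ is $j$-dimensional Lebesgue measure (in $H$, inside the integral)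 and $\triangle$ is the symmetric difference. Then the integrand is finite and $\nu_j$-integrable for all $K,L\in\mathcal{K}^n$, so that $\delta_j:\mathcal{K}^n\times\mathcal{K}^n\to[0,\infty)$ is well defined, and: (i) for every integer $k\ge j$, $\delta_j$ is a metric on $\mathcal{K}^n_k$; for every integer $0\le k<j$, $\delta_j$ is a pseudometric, but not a metric, on $\mathcal{K}^n_k$; moreover $\delta_j(K,L)=0$ for all $K,L\in\mathcal{K}^n$ with $\max\{\dim(K),\dim(L)\}<j$; (ii) $\delta_j$ is continuous on $\mathcal{K}^n\times\mathcal{K}^n$ with respect to the Hausdorff metric; (iii) $\delta_j(\vartheta K+x,\vartheta L+x)=\delta_j(K,L)$ for all $K,L\in\mathcal{K}^n$, all orthogonal transformations $\vartheta\in\mathrm{O}(\mathbb{R}^n)$ and all $x\in\mathbb{R}^n$; (iv) $\delta_j(tK,tL)=t^j\,\delta_j(K,L)$ for all $K,L\in\mathcal{K}^n$ and all $t>0$. -/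

import Mathlib

open MeasureTheory Module Set
open scoped Pointwise symmDiff

namespace IntrinsicVolume

noncomputable section

/-- Euclidean space `ℝⁿ`. -/
abbrev E (n : ℕ) : Type := EuclideanSpace ℝ (Fin n)

/-! ### The Grassmannian and its invariant probability measure -/

/-- The Grassmannian `Gr(n, j)` of all `j`-dimensional linear subspaces of `ℝⁿ`. -/
def Gr (n j : ℕ) : Type := {H : Submodule ℝ (E n) // finrank ℝ H = j}

namespace Gr

variable {n j : ℕ}

/-- The standard topology of the Grassmannian: a subspace is identified with the orthogonal
projection onto it, and orthogonal projections carry the operator norm topology. -/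
instance : TopologicalSpace (Gr n j) :=
  TopologicalSpace.induced (fun H => (H.1.starProjection : E n →L[ℝ] E n)) inferInstance

instance : MeasurableSpace (Gr n j) := borel _

instance : BorelSpace (Gr n j) := ⟨rfl⟩

/-- The coordinate subspace of `ℝⁿ` spanned by the first `j` standard basis vectors. -/
def coord (h : j ≤ n) : Gr n j :=
  ⟨Submodule.span ℝ
      (range fun i : Fin j => (EuclideanSpace.single (Fin.castLE h i) (1 : ℝ) : E n)), by
    have h1 : Orthonormal ℝ
        (fun i : Fin j => (EuclideanSpace.single (Fin.castLE h i) (1 : ℝ) : E n)) :=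
      (EuclideanSpace.orthonormal_single (𝕜 := ℝ) (ι := Fin n)).comp _ (Fin.castLE_injective h)
    simpa using finrank_span_eq_card h1.linearIndependent⟩

/-- The image `ϑ H` of a subspace `H` under an orthogonal transformation `ϑ`. -/
def rotate (g : E n ≃ₗᵢ[ℝ] E n) (H : Gr n j) : Gr n j :=
  ⟨H.1.map (g.toLinearEquiv : E n →ₗ[ℝ] E n), by
    rw [LinearEquiv.finrank_map_eq]; exact H.2⟩

end Gr

/-- The orthogonal group `O(n)`, with the topology of the operator norm (and the Borel
σ-algebra). -/
abbrev O (n : ℕ) : Type := unitary (E n →L[ℝ] E n)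

instance (n : ℕ) : ContinuousStar (E n →L[ℝ] E n) :=
  ⟨(ContinuousLinearMap.adjoint (𝕜 := ℝ) (E := E n) (F := E n)).continuous⟩

instance (n : ℕ) : CompactSpace (O n) := by
  refine isCompact_iff_compactSpace.mp ?_
  have : ProperSpace (E n →L[ℝ] E n) := FiniteDimensional.proper ℝ _
  refine Metric.isCompact_of_isClosed_isBounded isClosed_unitary ?_
  refine (Metric.isBounded_closedBall (x := (0 : E n →L[ℝ] E n)) (r := 1)).subset ?_
  intro u hu
  rw [mem_closedBall_zero_iff]
  refine ContinuousLinearMap.opNorm_le_bound _ zero_le_one fun x => ?_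
  rw [one_mul]
  exact (Unitary.norm_map ⟨u, hu⟩ x).le

/-- The Haar probability measure on the orthogonal group `O(n)`. -/
def haarO (n : ℕ) : Measure (O n) := Measure.haarMeasure ⊤

instance (n : ℕ) : IsProbabilityMeasure (haarO n) :=
  ⟨Measure.haarMeasure_self (K₀ := (⊤ : TopologicalSpace.PositiveCompacts (O n)))⟩

instance (n : ℕ) : (haarO n).IsMulLeftInvariant :=
  inferInstanceAs (Measure.haarMeasure ⊤).IsMulLeftInvariant

namespace Gr

variable {n j : ℕ}

theorem starProjection_rotate (u : O n) (H : Gr n j) :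
    (rotate (Unitary.linearIsometryEquiv u) H).1.starProjection
      = (u : E n →L[ℝ] E n) * H.1.starProjection * star (u : E n →L[ℝ] E n) := by
  ext1 x
  exact Submodule.starProjection_map_apply (Unitary.linearIsometryEquiv u) H.1 x

theorem continuous_rotate (H : Gr n j) :
    Continuous fun u : O n => rotate (Unitary.linearIsometryEquiv u) H := by
  refine continuous_induced_rng.mpr ?_
  change Continuous fun u : O n =>
    (rotate (Unitary.linearIsometryEquiv u) H).1.starProjection
  simp only [starProjection_rotate]
  have h : Continuous fun u : O n => (u : E n →L[ℝ] E n) := continuous_subtype_val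
  exact (h.mul continuous_const).mul h.star

/-- The `O(n)`-invariant Borel probability measure `ν_j` on `Gr(n, j)`: the law of `ϑ H₀`, where
`H₀` is a fixed `j`-dimensional subspace and `ϑ` is distributed according to the Haar probability
measure on `O(n)`. -/
def haar (h : j ≤ n) : Measure (Gr n j) :=
  (haarO n).map fun u => rotate (Unitary.linearIsometryEquiv u) (coord h)

instance (h : j ≤ n) : IsProbabilityMeasure (haar h) :=
  Measure.isProbabilityMeasure_map (continuous_rotate (coord h)).measurable.aemeasurable

/-- `ν_j` is invariant under the action of the orthogonal group. -/
theorem map_rotate_haar (h : j ≤ n) (u : O n) :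
    (haar h).map (rotate (Unitary.linearIsometryEquiv u)) = haar h := by
  have hm : Measurable (rotate (j := j) (Unitary.linearIsometryEquiv u)) := by
    refine Continuous.measurable (continuous_induced_rng.mpr ?_)
    change Continuous fun H : Gr n j =>
      (rotate (Unitary.linearIsometryEquiv u) H).1.starProjection
    simp only [starProjection_rotate]
    exact (continuous_const.mul continuous_induced_dom).mul continuous_const
  have hl : (haarO n).map (fun v => u * v) = haarO n := map_mul_left_eq_self _ u
  rw [haar, Measure.map_map hm (continuous_rotate _).measurable]
  conv_rhs => rw [← hl]
  rw [Measure.map_map (continuous_rotate _).measurable (continuous_const_mul u).measurable]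
  congr 1
  funext v
  refine Subtype.ext ?_
  exact (Submodule.map_comp _ _ _).symm

end Gr

/-! ### The intrinsic volume metric -/

/-- The volume of the Euclidean unit ball of `ℝᵐ`. -/
def ballVol (m : ℕ) : ℝ := (volume (Metric.closedBall (0 : E m) 1)).toReal

/-- The flag coefficient of Klain and Rota. -/
def flagCoeff (n j : ℕ) : ℝ :=
  (n.choose j : ℝ) * (ballVol n / (ballVol j * ballVol (n - j)))

/-- The orthogonal projection `K | H` of a set `K` into the subspace `H`, as a subset of `H`. -/
def shadow {n j : ℕ} (K : Set (E n)) (H : Gr n j) : Set H.1 :=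
  H.1.orthogonalProjectionOnto '' K

/-- `vol_j ((K | H) ∆ (L | H))`, where `vol_j` is the Lebesgue measure of the Euclidean space
`H`. -/
def shadowVol {n j : ℕ} (K L : Set (E n)) (H : Gr n j) : ENNReal :=
  @volume H.1 measureSpaceOfInnerProductSpace (shadow K H ∆ shadow L H)

/-- The `j`th intrinsic volume metric `δ_j` on the convex bodies (the nonempty compact convex
subsets) of `ℝⁿ`, for `j ≤ n`. -/
def delta {n j : ℕ} (h : j ≤ n) (K L : ConvexBody (E n)) : ℝ :=
  flagCoeff n j * ∫ H : Gr n j, (shadowVol (K : Set (E n)) L H).toReal ∂(Gr.haar h)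

/-! ### Notions in the statement -/

/-- The dimension of a convex body: the dimension of its affine hull. -/
def dim {n : ℕ} (K : ConvexBody (E n)) : ℕ :=
  finrank ℝ (affineSpan ℝ (K : Set (E n))).direction

/-- The class of convex bodies in `ℝⁿ` of dimension at least `k`. -/
def bodies (n k : ℕ) : Set (ConvexBody (E n)) := {K | k ≤ dim K}

/-- `d` is a pseudometric on the set `S`. -/
structure IsPseudometricOn {X : Type*} (S : Set X) (d : X → X → ℝ) : Prop where
  nonneg : ∀ x ∈ S, ∀ y ∈ S, 0 ≤ d x y
  self : ∀ x ∈ S, d x x = 0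
  symm : ∀ x ∈ S, ∀ y ∈ S, d x y = d y x
  triangle : ∀ x ∈ S, ∀ y ∈ S, ∀ z ∈ S, d x z ≤ d x y + d y z

/-- `d` is a metric on the set `S`. -/
structure IsMetricOn {X : Type*} (S : Set X) (d : X → X → ℝ) : Prop
    extends IsPseudometricOn S d where
  eq_of_eq_zero : ∀ x ∈ S, ∀ y ∈ S, d x y = 0 → x = y

/-- The image `ϑ K + x` of a convex body under a rigid motion. -/
def rigidMotion {n : ℕ} (g : E n ≃ₗᵢ[ℝ] E n) (x : E n) (K : ConvexBody (E n)) :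
    ConvexBody (E n) where
  carrier := (fun y => g y + x) '' (K : Set (E n))
  convex' := by
    have h := (K.convex.linear_image (g.toLinearEquiv : E n →ₗ[ℝ] E n)).translate_preimage_left
      (-x)
    have e : (fun y => g y + x) '' (K : Set (E n))
        = (fun z => z + -x) ⁻¹' ((g.toLinearEquiv : E n →ₗ[ℝ] E n) '' (K : Set (E n))) := by
      ext z
      simp [eq_sub_iff_add_eq, ← sub_eq_add_neg]
    rw [e]
    exact h
  isCompact' := K.isCompact.image (g.continuous.add continuous_const)
  nonempty' := K.nonempty.image _

end

end IntrinsicVolume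

/-! Everything reduces to the volume of `(K|H) ∆ (L|H)` for a single `H`. The pseudometric axioms,
homogeneity, translation invariance and vanishing in low dimension hold pointwise in `H`; rotations
are absorbed by the invariance of `ν_j`.

For continuity, write `H = u H₀`. Up to an isometry the shadow in `H` is the image of the body under
`P_{H₀} u*`, so all volumes are taken in one fixed space. The volume of a symmetric difference is
Hausdorff continuous because boundaries of convex bodies are null, and the integrand is jointly
continuous in `(K, L, u)`. Compactness of `O(n)` gives integrability and continuity of the integral.

For definiteness, let `x ∈ K \ L` with `dim K ≥ j`, and let `V` be the direction of the affine hull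
of `K`. Separate `x` from `L` by a vector `u ∉ Vᗮ`, and choose `H ∋ u` with `H ∩ Vᗮ = 0`. Then `K|H`
has interior points, and the shadow of `x` is not in `L|H`, so the integrand is positive at `H`. By
continuity and full support of `ν_j` the integral is positive (`exists_shadowVol_pos`,
`subset_of_delta_eq_zero`). -/

open Filter Topology

namespace ConvexBody

/-! ### Hausdorff distance and linear images of convex bodies -/

section Hausdorff

variable {V : Type*} [NormedAddCommGroup V] [NormedSpace ℝ V]

theorem exists_mem_dist_lt {K L : ConvexBody V} {r : ℝ} {x : V} (h : dist K L < r) (hx : x ∈ K) :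
    ∃ y ∈ L, dist x y < r :=
  Metric.exists_dist_lt_of_hausdorffDist_lt (s := (K : Set V)) (t := (L : Set V)) hx
    (by rwa [hausdorffDist_coe]) hausdorffEDist_ne_top

theorem exists_mem_dist_le (K L : ConvexBody V) {x : V} (hx : x ∈ K) :
    ∃ y ∈ L, dist x y ≤ dist K L := by
  obtain ⟨y, hy, hxy⟩ := L.isCompact.exists_infDist_eq_dist L.nonempty x
  refine ⟨y, hy, ?_⟩
  rw [← hxy, ← hausdorffDist_coe]
  exact Metric.infDist_le_hausdorffDist_of_mem hx hausdorffEDist_ne_top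

theorem dist_le_of_mem_dist {K L : ConvexBody V} {r : ℝ} (hr : 0 ≤ r)
    (h₁ : ∀ x ∈ K, ∃ y ∈ L, dist x y ≤ r) (h₂ : ∀ x ∈ L, ∃ y ∈ K, dist x y ≤ r) :
    dist K L ≤ r := by
  rw [← hausdorffDist_coe]
  exact Metric.hausdorffDist_le_of_mem_dist hr h₁ h₂

theorem subset_thickening {K L : ConvexBody V} {r : ℝ} (h : dist K L < r) :
    (K : Set V) ⊆ Metric.thickening r (L : Set V) := fun _ hx =>
  Metric.mem_thickening_iff.mpr (exists_mem_dist_lt h hx)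

theorem eventually_notMem {ι : Type*} {l : Filter ι} {A : ι → ConvexBody V} {K : ConvexBody V}
    (hA : Tendsto A l (𝓝 K)) {x : V} (hx : x ∉ K) : ∀ᶠ i in l, x ∉ A i := by
  have hpos : 0 < Metric.infDist x (K : Set V) :=
    (K.isClosed.notMem_iff_infDist_pos K.nonempty).mp hx
  filter_upwards [Metric.tendsto_nhds.mp hA _ hpos] with i hi hxi
  obtain ⟨y, hy, hxy⟩ := exists_mem_dist_lt hi hxi
  exact absurd (Metric.infDist_le_dist_of_mem hy) (not_le.mpr hxy)

/-- The image of a convex body under a continuous linear map. -/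
def map {W : Type*} [NormedAddCommGroup W] [NormedSpace ℝ W] (T : V →L[ℝ] W)
    (K : ConvexBody V) : ConvexBody W where
  carrier := T '' (K : Set V)
  convex' := K.convex.linear_image (T : V →ₗ[ℝ] W)
  isCompact' := K.isCompact.image T.continuous
  nonempty' := K.nonempty.image _

variable {W : Type*} [NormedAddCommGroup W] [NormedSpace ℝ W]

@[simp]
theorem coe_map (T : V →L[ℝ] W) (K : ConvexBody V) : (K.map T : Set W) = T '' (K : Set V) := rfl

/-- This follows from `S y - T x = S (y - x) + (S - T) x`. Only the fixed body `K` needs a norm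
bound, so the right side tends to `0` as `(S, L) → (T, K)`. -/
theorem dist_map_le {S T : V →L[ℝ] W} {K L : ConvexBody V} {R : ℝ}
    (hR : ∀ x ∈ K, ‖x‖ ≤ R) :
    dist (L.map S) (K.map T) ≤ ‖S‖ * dist L K + ‖S - T‖ * R := by
  have hR0 : 0 ≤ R := by
    obtain ⟨x, hx⟩ := K.nonempty
    exact (norm_nonneg x).trans (hR x hx)
  have key : ∀ x ∈ K, ∀ y : V, dist y x ≤ dist L K →
      dist (S y) (T x) ≤ ‖S‖ * dist L K + ‖S - T‖ * R := by
    intro x hx y hxy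
    have e : S y - T x = S (y - x) + (S - T) x := by simp
    rw [dist_eq_norm, e]
    refine (norm_add_le _ _).trans (add_le_add ?_ ?_)
    · rw [dist_eq_norm] at hxy
      exact (S.le_opNorm _).trans (by gcongr)
    · exact ((S - T).le_opNorm _).trans (by gcongr; exact hR x hx)
  refine dist_le_of_mem_dist (by positivity) ?_ ?_
  · rintro _ ⟨y, hy, rfl⟩
    obtain ⟨x, hx, hyx⟩ := exists_mem_dist_le L K hy
    exact ⟨T x, ⟨x, hx, rfl⟩, key x hx y hyx⟩
  · rintro _ ⟨x, hx, rfl⟩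
    obtain ⟨y, hy, hxy⟩ := exists_mem_dist_le K L hx
    rw [dist_comm, dist_comm K] at hxy
    exact ⟨S y, ⟨y, hy, rfl⟩, by rw [dist_comm]; exact key x hx y hxy⟩

theorem continuous_map :
    Continuous fun p : (V →L[ℝ] W) × ConvexBody V => p.2.map p.1 := by
  rw [continuous_iff_continuousAt]
  rintro ⟨T, K⟩
  obtain ⟨R, hR⟩ := K.isBounded.exists_norm_le
  rw [ContinuousAt, tendsto_iff_dist_tendsto_zero]
  refine squeeze_zero (fun _ => dist_nonneg) (fun p => dist_map_le (S := p.1) (L := p.2) hR) ?_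
  have hc : Continuous fun p : (V →L[ℝ] W) × ConvexBody V =>
      ‖p.1‖ * dist p.2 K + ‖p.1 - T‖ * R := by fun_prop
  simpa using hc.tendsto (T, K)

end Hausdorff

/-! ### Symmetric differences of convex bodies -/

section Measure

variable {F : Type*} [NormedAddCommGroup F] [NormedSpace ℝ F] [MeasurableSpace F]

theorem measure_symmDiff_lt_top (μ : Measure F) [IsFiniteMeasureOnCompacts μ]
    (K L : ConvexBody F) : μ ((K : Set F) ∆ (L : Set F)) < ⊤ :=
  (measure_mono symmDiff_subset_union).trans_lt
    (K.isCompact.union L.isCompact).measure_lt_top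

theorem measurableSet_symmDiff [BorelSpace F] (K L : ConvexBody F) :
    MeasurableSet ((K : Set F) ∆ (L : Set F)) :=
  K.isClosed.measurableSet.symmDiff L.isClosed.measurableSet

/-- Two convex bodies, the first of which has interior points and is not contained in the second,
differ by a set of positive measure. -/
theorem measure_symmDiff_pos (μ : Measure F) [μ.IsOpenPosMeasure] {K L : ConvexBody F}
    (hK : (interior (K : Set F)).Nonempty)
    {x : F} (hx : x ∈ K) (hxL : x ∉ L) : 0 < μ ((K : Set F) ∆ (L : Set F)) := by
  -- `K` lies in the closure of its interior, so the open neighbourhood `Lᶜ` of `x` meets that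
  -- interior in a nonempty open set.
  have hcl : x ∈ closure (interior (K : Set F)) := by
    rw [K.convex.closure_interior_eq_closure_of_nonempty_interior hK]
    exact subset_closure hx
  have hne : ((L : Set F)ᶜ ∩ interior (K : Set F)).Nonempty :=
    mem_closure_iff.mp hcl _ L.isClosed.isOpen_compl hxL
  refine ((L.isClosed.isOpen_compl.inter isOpen_interior).measure_pos μ hne).trans_le
    (measure_mono fun y hy => Or.inl ⟨interior_subset hy.2, hy.1⟩)

end Measure

/-! ### Hausdorff continuity of the volume of a symmetric difference -/

section Volume

variable {F : Type*} [NormedAddCommGroup F] [InnerProductSpace ℝ F] [FiniteDimensional ℝ F]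

/-- If `x ∉ A i`, move `x` by `r` along the normal of a separating hyperplane, away from `A i`. The
new point is still in `K`, but at distance more than `r` from every point of `A i`. -/
theorem eventually_mem_of_mem_interior {ι : Type*} {l : Filter ι} {A : ι → ConvexBody F}
    {K : ConvexBody F} (hA : Tendsto A l (𝓝 K)) {x : F} (hx : x ∈ interior (K : Set F)) :
    ∀ᶠ i in l, x ∈ A i := by
  obtain ⟨r, hr, hball⟩ := Metric.nhds_basis_closedBall.mem_iff.mp (mem_interior_iff_mem_nhds.mp hx)
  filter_upwards [Metric.tendsto_nhds.mp hA r hr] with i hi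
  by_contra hxi
  obtain ⟨f, c, hf, hfx⟩ :=
    geometric_hahn_banach_closed_point (A i).convex (A i).isClosed hxi
  obtain ⟨v, rfl⟩ := (InnerProductSpace.toDual ℝ F).surjective f
  simp only [InnerProductSpace.toDual_apply_apply] at hf hfx
  have hv : 0 < ‖v‖ := by
    obtain ⟨a, ha⟩ := (A i).nonempty
    refine norm_pos_iff.mpr fun h => ?_
    have := (hf a ha).trans hfx
    simp [h] at this
  have hz : x + (r / ‖v‖) • v ∈ K := by
    refine hball ?_
    rw [Metric.mem_closedBall, dist_eq_norm, add_sub_cancel_left, norm_smul, norm_div, norm_norm,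
      div_mul_cancel₀ _ hv.ne', Real.norm_of_nonneg hr.le]
  obtain ⟨a, ha, hza⟩ := exists_mem_dist_lt (by rwa [dist_comm]) hz
  have h1 : inner ℝ v (x + (r / ‖v‖) • v - a) ≤ ‖v‖ * dist (x + (r / ‖v‖) • v) a := by
    rw [dist_eq_norm]
    exact real_inner_le_norm _ _
  have h2 : inner ℝ v ((r / ‖v‖) • v) = ‖v‖ * r := by
    rw [real_inner_smul_right, real_inner_self_eq_norm_sq]
    field_simp
  rw [inner_sub_right, inner_add_right, h2] at h1
  have := mul_lt_mul_of_pos_left hza hv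
  linarith [(hf a ha).trans hfx]

variable [MeasurableSpace F] [BorelSpace F] (μ : Measure F) [μ.IsAddHaarMeasure]

theorem ae_eventually_mem_iff {ι : Type*} {l : Filter ι} {A : ι → ConvexBody F}
    {K : ConvexBody F} (hA : Tendsto A l (𝓝 K)) :
    ∀ᵐ x ∂μ, ∀ᶠ i in l, x ∈ (A i : Set F) ↔ x ∈ (K : Set F) := by
  have h0 : ∀ᵐ x ∂μ, x ∉ frontier (K : Set F) :=
    measure_eq_zero_iff_ae_notMem.mp (K.convex.addHaar_frontier μ)
  filter_upwards [h0] with x hx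
  by_cases hxK : x ∈ (K : Set F)
  · have hxi : x ∈ interior (K : Set F) := by
      by_contra h
      exact hx ⟨subset_closure hxK, h⟩
    filter_upwards [eventually_mem_of_mem_interior hA hxi] with i hi
    exact iff_of_true hi hxK
  · filter_upwards [eventually_notMem hA hxK] with i hi
    exact iff_of_false hi hxK

/-- Dominated convergence: off the null boundaries of the limit bodies, membership is eventually
constant, and nearby bodies stay in the bounded set `B`. -/
theorem continuous_measure_symmDiff :
    Continuous fun p : ConvexBody F × ConvexBody F => μ ((p.1 : Set F) ∆ (p.2 : Set F)) := by
  rw [continuous_iff_continuousAt]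
  rintro ⟨K, L⟩
  have h1 : Tendsto (fun p : ConvexBody F × ConvexBody F => p.1) (𝓝 (K, L)) (𝓝 K) :=
    continuous_fst.tendsto _
  have h2 : Tendsto (fun p : ConvexBody F × ConvexBody F => p.2) (𝓝 (K, L)) (𝓝 L) :=
    continuous_snd.tendsto _
  refine tendsto_measure_of_ae_tendsto_indicator (𝓝 (K, L)) (measurableSet_symmDiff K L)
    (fun p => measurableSet_symmDiff p.1 p.2)
    (B := Metric.thickening 1 (K : Set F) ∪ Metric.thickening 1 (L : Set F))
    (Metric.isOpen_thickening.union Metric.isOpen_thickening).measurableSet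
    (K.isBounded.thickening.union L.isBounded.thickening).measure_lt_top.ne ?_ ?_
  · filter_upwards [Metric.tendsto_nhds.mp h1 1 one_pos, Metric.tendsto_nhds.mp h2 1 one_pos]
      with p hp1 hp2
    exact symmDiff_subset_union.trans
      (union_subset_union (subset_thickening hp1) (subset_thickening hp2))
  · filter_upwards [ae_eventually_mem_iff μ h1, ae_eventually_mem_iff μ h2] with x hx1 hx2
    filter_upwards [hx1, hx2] with p hp1 hp2
    simp only [mem_symmDiff, hp1, hp2]

theorem continuous_measureReal_symmDiff :
    Continuous fun p : ConvexBody F × ConvexBody F =>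
      (μ ((p.1 : Set F) ∆ (p.2 : Set F))).toReal :=
  ENNReal.continuousOn_toReal.comp_continuous (continuous_measure_symmDiff μ)
    fun p => (measure_symmDiff_lt_top μ p.1 p.2).ne

theorem measure_image_eq_zero_of_finrank_lt {V : Type*} [NormedAddCommGroup V]
    [NormedSpace ℝ V] [FiniteDimensional ℝ V] (T : V →ₗ[ℝ] F) {s : Set V}
    (hs : finrank ℝ (affineSpan ℝ s).direction < finrank ℝ F) : μ (T '' s) = 0 := by
  refine measure_mono_null (subset_affineSpan ℝ _)
    (Measure.addHaar_affineSubspace μ (affineSpan ℝ (T '' s)) fun htop => ?_)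
  have hmap : (affineSpan ℝ s).map T.toAffineMap = ⊤ :=
    (AffineSubspace.map_span T.toAffineMap s).trans htop
  have hdir := congrArg AffineSubspace.direction hmap
  rw [AffineSubspace.map_direction, AffineSubspace.direction_top] at hdir
  have hle := Submodule.finrank_map_le T (affineSpan ℝ s).direction
  rw [LinearMap.toAffineMap_linear] at hdir
  rw [hdir, finrank_top] at hle
  omega

theorem continuous_measureReal_map_symmDiff {X V : Type*} [TopologicalSpace X]
    [NormedAddCommGroup V] [NormedSpace ℝ V] {T : X → V →L[ℝ] F} {K L : X → ConvexBody V}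
    (hT : Continuous T) (hK : Continuous K) (hL : Continuous L) :
    Continuous fun x =>
      (μ (((K x).map (T x) : Set F) ∆ ((L x).map (T x) : Set F))).toReal :=
  (continuous_measureReal_symmDiff μ).comp
    ((continuous_map.comp (hT.prodMk hK)).prodMk (continuous_map.comp (hT.prodMk hL)))

end Volume

end ConvexBody


theorem Submodule.exists_between_finrank_eq {K V : Type*} [DivisionRing K] [AddCommGroup V]
    [Module K V] [Module.Finite K V] {S T : Submodule K V} (hST : S ≤ T) {j : ℕ}
    (hS : finrank K S ≤ j) (hT : j ≤ finrank K T) :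
    ∃ W : Submodule K V, S ≤ W ∧ W ≤ T ∧ finrank K W = j := by
  induction j, hS using Nat.le_induction with
  | base => exact ⟨S, le_rfl, hST, rfl⟩
  | succ m _ ih =>
    obtain ⟨W, hSW, hWT, hW⟩ := ih (by omega)
    obtain ⟨v, hvT, hvW⟩ := SetLike.exists_of_lt
      (lt_of_le_of_ne hWT fun h => by rw [h] at hW; omega)
    refine ⟨W ⊔ K ∙ v, hSW.trans le_sup_left, sup_le hWT ?_, ?_⟩
    · rwa [Submodule.span_singleton_le_iff_mem]
    · rw [finrank_sup_span_singleton hvW, hW]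

namespace IntrinsicVolume

attribute [local instance] measureSpaceOfInnerProductSpace

/-! ### Volumes of shadows for a fixed subspace -/

variable {n j : ℕ}

theorem shadowVol_eq (K L : ConvexBody (E n)) (H : Gr n j) :
    shadowVol (K : Set (E n)) L H =
      volume ((K.map H.1.orthogonalProjectionOnto : Set H.1) ∆
        (L.map H.1.orthogonalProjectionOnto : Set H.1)) := rfl

theorem shadowVol_lt_top (K L : ConvexBody (E n)) (H : Gr n j) :
    shadowVol (K : Set (E n)) L H < ⊤ := by
  rw [shadowVol_eq]
  exact ConvexBody.measure_symmDiff_lt_top volume _ _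

theorem shadowVol_self (K : Set (E n)) (H : Gr n j) : shadowVol K K H = 0 := by
  simp [shadowVol]

theorem shadowVol_comm (K L : Set (E n)) (H : Gr n j) : shadowVol K L H = shadowVol L K H := by
  rw [shadowVol, symmDiff_comm, shadowVol]

theorem shadowVol_triangle (K L M : Set (E n)) (H : Gr n j) :
    shadowVol K M H ≤ shadowVol K L H + shadowVol L M H :=
  measure_symmDiff_le _ _ _

theorem shadowVol_smul {t : ℝ} (ht : 0 < t) (K L : Set (E n)) (H : Gr n j) :
    shadowVol (t • K) (t • L) H = ENNReal.ofReal (t ^ j) * shadowVol K L H := by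
  have h : ∀ K : Set (E n), shadow (t • K) H = t • shadow K H := fun K =>
    image_smul_comm _ _ _ fun x => map_smul _ _ _
  rw [shadowVol, h, h, ← smul_set_symmDiff₀ ht.ne', Measure.addHaar_smul, H.2,
    abs_of_pos (pow_pos ht j), shadowVol]

theorem shadowVol_image_add (K L : Set (E n)) (x : E n) (H : Gr n j) :
    shadowVol ((fun y => y + x) '' K) ((fun y => y + x) '' L) H = shadowVol K L H := by
  have h : ∀ K : Set (E n), shadow ((fun y => y + x) '' K) H =
      (fun y => y + H.1.orthogonalProjectionOnto x) '' shadow K H := by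
    intro K
    simp only [shadow, image_image, map_add]
  rw [shadowVol, h, h, ← image_symmDiff (add_left_injective _), image_add_right,
    measure_preimage_add_right, shadowVol]

/-- The projection onto `g H` is the conjugate by `g` of the projection onto `H`. -/
theorem shadow_rotate (g : E n ≃ₗᵢ[ℝ] E n) (K : Set (E n)) (H : Gr n j) :
    shadow (g '' K) (Gr.rotate g H) = g.submoduleMap H.1 '' shadow K H := by
  simp only [shadow, image_image]
  refine image_congr fun x _ => Subtype.ext ?_
  have h := Submodule.starProjection_map_apply g H.1 (g x)
  rw [g.symm_apply_apply] at h
  exact h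

theorem _root_.LinearIsometryEquiv.volume_image_symmDiff {F F' : Type*}
    [NormedAddCommGroup F] [InnerProductSpace ℝ F] [FiniteDimensional ℝ F] [MeasurableSpace F]
    [BorelSpace F] [NormedAddCommGroup F'] [InnerProductSpace ℝ F'] [FiniteDimensional ℝ F']
    [MeasurableSpace F'] [BorelSpace F'] (e : F ≃ₗᵢ[ℝ] F') (A B : Set F) :
    volume ((e '' A) ∆ (e '' B)) = volume (A ∆ B) := by
  rw [← image_symmDiff e.injective, e.image_eq_preimage_symm]
  exact e.symm.measurePreserving.measure_preimage_equiv
    (f := e.symm.toHomeomorph.toMeasurableEquiv) _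

theorem shadowVol_rotate (g : E n ≃ₗᵢ[ℝ] E n) (K L : Set (E n)) (H : Gr n j) :
    shadowVol (g '' K) (g '' L) (Gr.rotate g H) = shadowVol K L H := by
  rw [shadowVol, shadow_rotate, shadow_rotate]
  exact (g.submoduleMap H.1).volume_image_symmDiff _ _

theorem shadowVol_eq_zero {K L : ConvexBody (E n)} (hK : dim K < j) (hL : dim L < j)
    (H : Gr n j) : shadowVol (K : Set (E n)) L H = 0 := by
  have h : ∀ K : ConvexBody (E n), dim K < j →
      (volume : Measure H.1) (shadow (K : Set (E n)) H) = 0 := by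
    intro K hK
    exact ConvexBody.measure_image_eq_zero_of_finrank_lt volume
      (H.1.orthogonalProjectionOnto : E n →ₗ[ℝ] H.1) (by rw [H.2]; exact hK)
  exact measure_mono_null symmDiff_subset_union (measure_union_null (h K hK) (h L hL))

/-! ### The Grassmannian as a homogeneous space -/

namespace Gr

theorem isEmbedding_starProjection :
    IsEmbedding (fun H : Gr n j => (H.1.starProjection : E n →L[ℝ] E n)) := by
  refine ⟨⟨rfl⟩, fun H H' h => Subtype.ext ?_⟩
  have h' : (H.1.starProjection : E n →L[ℝ] E n) = H'.1.starProjection := h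
  rw [← Submodule.range_starProjection H.1, h', Submodule.range_starProjection]

instance : T2Space (Gr n j) := isEmbedding_starProjection.t2Space

/-- An isometry between two subspaces of equal dimension extends to the whole space. -/
theorem exists_rotate_eq (H H' : Gr n j) :
    ∃ u : O n, rotate (Unitary.linearIsometryEquiv u) H = H' := by
  let e : H.1 ≃ₗᵢ[ℝ] H'.1 :=
    (stdOrthonormalBasis ℝ H.1).equiv (stdOrthonormalBasis ℝ H'.1)
      (finCongr (H.2.trans H'.2.symm))
  let f : E n →ₗᵢ[ℝ] E n := (H'.1.subtypeₗᵢ.comp e.toLinearIsometry).extend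
  have hf : ∀ x : H.1, f x = e x := fun x => LinearIsometry.extend_apply _ x
  let g : E n ≃ₗᵢ[ℝ] E n := f.toLinearIsometryEquiv rfl
  refine ⟨Unitary.linearIsometryEquiv.symm g, Subtype.ext ?_⟩
  rw [MulEquiv.apply_symm_apply]
  ext y
  constructor
  · rintro ⟨x, hx, rfl⟩
    have : g x = e ⟨x, hx⟩ := hf ⟨x, hx⟩
    exact this ▸ (e ⟨x, hx⟩).2
  · intro hy
    refine ⟨e.symm ⟨y, hy⟩, (e.symm ⟨y, hy⟩).2, ?_⟩
    have : g (e.symm ⟨y, hy⟩) = e (e.symm ⟨y, hy⟩) := hf _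
    rw [e.apply_symm_apply] at this
    exact this

/-- A continuous surjection from a compact space to a Hausdorff space is a quotient map. Continuity
on `Gr n j` can thus be tested on `O n`. -/
theorem isQuotientMap_rotate (H : Gr n j) :
    IsQuotientMap fun u : O n => rotate (Unitary.linearIsometryEquiv u) H :=
  (continuous_rotate H).isClosedMap.isQuotientMap (continuous_rotate H) (exists_rotate_eq H)

theorem continuous_rotate_left (u : O n) :
    Continuous fun H : Gr n j => rotate (Unitary.linearIsometryEquiv u) H := by
  refine continuous_induced_rng.mpr ?_
  change Continuous fun H : Gr n j =>
    (rotate (Unitary.linearIsometryEquiv u) H).1.starProjection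
  simp only [starProjection_rotate]
  exact (continuous_const.mul continuous_induced_dom).mul continuous_const

instance : (haarO n).IsOpenPosMeasure :=
  inferInstanceAs (Measure.haarMeasure ⊤).IsOpenPosMeasure

/-- Full support of `ν_j` lets positivity at one subspace give a positive integral. -/
instance (h : j ≤ n) : (haar h).IsOpenPosMeasure :=
  (continuous_rotate (coord h)).isOpenPosMeasure_map (isQuotientMap_rotate (coord h)).surjective

end Gr

/-! ### Continuity of the volume of the symmetric difference of the shadows -/

/-- The projection onto `H` after the inverse of the orthogonal transformation `u`; up to the
isometry `u : H → u H` this is the projection onto `u H`. -/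
noncomputable def projRotate (H : Gr n j) (u : O n) : E n →L[ℝ] H.1 :=
  H.1.orthogonalProjectionOnto.comp (star (u : E n →L[ℝ] E n))

theorem continuous_projRotate (H : Gr n j) : Continuous (projRotate H) := by
  have hs : Continuous fun u : O n => star (u : E n →L[ℝ] E n) := continuous_subtype_val.star
  exact (continuous_const (y := H.1.orthogonalProjectionOnto)).clm_comp hs

/-- Writing `K = u (u* K)` moves the dependence on `u` from the subspace to the linear map, so the
measure no longer varies. -/
theorem shadowVol_rotate_eq_map (u : O n) (H : Gr n j) (K L : ConvexBody (E n)) :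
    shadowVol (K : Set (E n)) L (Gr.rotate (Unitary.linearIsometryEquiv u) H) =
      volume ((K.map (projRotate H u) : Set H.1) ∆
        (L.map (projRotate H u) : Set H.1)) := by
  have h : ∀ K : ConvexBody (E n),
      Unitary.linearIsometryEquiv u '' (⇑(star (u : E n →L[ℝ] E n)) '' (K : Set (E n))) = K := by
    intro K
    rw [image_image]
    refine (image_congr fun x _ => ?_).trans (image_id _)
    exact (Unitary.linearIsometryEquiv u).apply_symm_apply x
  conv_lhs => rw [← h K, ← h L, shadowVol_rotate]
  simp only [shadowVol, shadow, image_image]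
  rfl

theorem continuous_shadowVol_rotate {X : Type*} [TopologicalSpace X] (H : Gr n j)
    {K L : X → ConvexBody (E n)} {u : X → O n} (hK : Continuous K) (hL : Continuous L)
    (hu : Continuous u) :
    Continuous fun x =>
      (shadowVol (K x : Set (E n)) (L x)
        (Gr.rotate (Unitary.linearIsometryEquiv (u x)) H)).toReal := by
  simp only [shadowVol_rotate_eq_map]
  exact ConvexBody.continuous_measureReal_map_symmDiff (volume : Measure H.1)
    ((continuous_projRotate H).comp hu) hK hL

theorem continuous_shadowVol (K L : ConvexBody (E n)) :
    Continuous fun H : Gr n j => (shadowVol (K : Set (E n)) L H).toReal := by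
  rcases isEmpty_or_nonempty (Gr n j) with _ | ⟨⟨H⟩⟩
  · exact continuous_of_const fun H => isEmptyElim H
  · rw [(Gr.isQuotientMap_rotate H).continuous_iff]
    exact continuous_shadowVol_rotate H (continuous_const (y := K)) (continuous_const (y := L))
      continuous_id

theorem integrable_shadowVol (h : j ≤ n) (K L : ConvexBody (E n)) :
    Integrable (fun H : Gr n j => (shadowVol (K : Set (E n)) L H).toReal) (Gr.haar h) := by
  have : CompactSpace (Gr n j) := (Gr.isQuotientMap_rotate (Gr.coord h)).surjective.compactSpace
    (Gr.continuous_rotate _)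
  exact (continuous_shadowVol K L).integrable_of_hasCompactSupport
    (HasCompactSupport.of_compactSpace _)

/-! ### Basic properties of the intrinsic volume metric -/

theorem ballVol_pos (m : ℕ) : 0 < ballVol m :=
  ENNReal.toReal_pos (Metric.measure_closedBall_pos _ _ one_pos).ne'
    (isCompact_closedBall _ _).measure_lt_top.ne

theorem flagCoeff_pos (h : j ≤ n) : 0 < flagCoeff n j :=
  mul_pos (by exact_mod_cast Nat.choose_pos h)
    (div_pos (ballVol_pos n) (mul_pos (ballVol_pos j) (ballVol_pos (n - j))))

theorem delta_nonneg (h : j ≤ n) (K L : ConvexBody (E n)) : 0 ≤ delta h K L :=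
  mul_nonneg (flagCoeff_pos h).le (integral_nonneg fun _ => ENNReal.toReal_nonneg)

theorem isPseudometricOn_delta (h : j ≤ n) (S : Set (ConvexBody (E n))) :
    IsPseudometricOn S (delta h) where
  nonneg K _ L _ := delta_nonneg h K L
  self K _ := by simp [delta, shadowVol_self]
  symm K _ L _ := by simp only [delta, shadowVol_comm (K : Set (E n))]
  triangle K _ L _ M _ := by
    rw [delta, delta, delta, ← mul_add,
      ← integral_add (integrable_shadowVol h K L) (integrable_shadowVol h L M)]
    refine mul_le_mul_of_nonneg_left (integral_mono (integrable_shadowVol h K M)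
      ((integrable_shadowVol h K L).add (integrable_shadowVol h L M)) fun H => ?_)
      (flagCoeff_pos h).le
    have hKL := (shadowVol_lt_top K L H).ne
    have hLM := (shadowVol_lt_top L M H).ne
    beta_reduce
    rw [← ENNReal.toReal_add hKL hLM]
    exact ENNReal.toReal_mono (ENNReal.add_ne_top.mpr ⟨hKL, hLM⟩) (shadowVol_triangle _ _ _ H)

theorem delta_eq_zero_of_dim_lt (h : j ≤ n) {K L : ConvexBody (E n)} (hK : dim K < j)
    (hL : dim L < j) : delta h K L = 0 := by
  simp [delta, shadowVol_eq_zero hK hL]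

theorem delta_smul (h : j ≤ n) {t : ℝ} (ht : 0 < t) (K L : ConvexBody (E n)) :
    delta h (t • K) (t • L) = t ^ j * delta h K L := by
  simp only [delta, ConvexBody.coe_smul, shadowVol_smul ht, ENNReal.toReal_mul,
    ENNReal.toReal_ofReal (pow_pos ht j).le, integral_const_mul]
  ring

theorem delta_rigidMotion (h : j ≤ n) (g : E n ≃ₗᵢ[ℝ] E n) (x : E n) (K L : ConvexBody (E n)) :
    delta h (rigidMotion g x K) (rigidMotion g x L) = delta h K L := by
  obtain ⟨u, rfl⟩ := Unitary.linearIsometryEquiv.surjective g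
  have hcoe : ∀ K : ConvexBody (E n),
      (rigidMotion (Unitary.linearIsometryEquiv u) x K : Set (E n)) =
        (fun y => y + x) '' (Unitary.linearIsometryEquiv u '' (K : Set (E n))) := by
    intro K
    rw [image_image]
    rfl
  rw [delta, delta]
  congr 1
  -- By invariance `H` may be replaced by `u H`; then bodies and subspace are rotated together.
  conv_lhs => rw [← Gr.map_rotate_haar h u]
  rw [integral_map (Gr.continuous_rotate_left u).measurable.aemeasurable
    (continuous_shadowVol _ _).aestronglyMeasurable]
  simp only [hcoe, shadowVol_image_add, shadowVol_rotate]

theorem continuous_delta (h : j ≤ n) :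
    Continuous fun p : ConvexBody (E n) × ConvexBody (E n) => delta h p.1 p.2 := by
  -- Currying the jointly continuous integrand gives a continuous map into `C(O n, ℝ)` with the
  -- uniform topology, on which integration is continuous.
  let Φ : C(ConvexBody (E n) × ConvexBody (E n), C(O n, ℝ)) :=
    ContinuousMap.curry ⟨_, continuous_shadowVol_rotate (Gr.coord h)
      (continuous_fst.comp continuous_fst) (continuous_snd.comp continuous_fst) continuous_snd⟩
  have hint : Continuous fun f : C(O n, ℝ) => ∫ u, f u ∂(haarO n) := by
    have h1 : Continuous fun f : C(O n, ℝ) =>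
        ∫ u, (ContinuousMap.toLp 1 (haarO n) ℝ f : O n → ℝ) u ∂(haarO n) :=
      continuous_integral.comp (ContinuousMap.toLp 1 (haarO n) ℝ).continuous
    refine h1.congr fun f => integral_congr_ae (ContinuousMap.coeFn_toLp (haarO n) f)
  refine ((hint.comp Φ.continuous).const_mul (flagCoeff n j)).congr fun p => ?_
  rw [delta, Gr.haar, integral_map (Gr.continuous_rotate _).measurable.aemeasurable
    (continuous_shadowVol _ _).aestronglyMeasurable]
  rfl



/-! ### Definiteness in dimension at least `j` -/

/-- A vector `u` outside `Vᗮ` lies in a `j`-dimensional subspace that meets `Vᗮ` trivially. -/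
theorem Gr.exists_mem_disjoint_orthogonal (hj : 1 ≤ j) {V : Submodule ℝ (E n)}
    (hV : j ≤ finrank ℝ V) {u : E n} (hu : u ∉ Vᗮ) :
    ∃ H : Gr n j, u ∈ H.1 ∧ Disjoint H.1 Vᗮ := by
  -- Take a `j`-dimensional `W ≤ V` containing `w`, and shear it by a map `A` with `A w = u` that
  -- moves points only along `u - w ∈ Vᗮ`. Projection to `V` inverts `A` on `V`, so `A` is injective
  -- on `W` and `A W` meets `Vᗮ` only in `0`.
  set w : E n := V.starProjection u with hw
  have hw0 : w ≠ 0 := fun h => hu ((Submodule.starProjection_apply_eq_zero_iff V).mp h)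
  have hwV : w ∈ V := Submodule.starProjection_apply_mem V u
  obtain ⟨W, hwW, hWV, hW⟩ := Submodule.exists_between_finrank_eq (S := ℝ ∙ w) (T := V) (j := j)
    ((Submodule.span_singleton_le_iff_mem w V).mpr hwV) (by rw [finrank_span_singleton hw0]; exact hj)
    hV
  have hPw : V.starProjection (u - w) = 0 := by
    rw [map_sub, ← hw, Submodule.starProjection_eq_self_iff.mpr hwV, sub_self]
  let φ : E n →ₗ[ℝ] ℝ := (‖w‖ ^ 2)⁻¹ • (innerSL ℝ w : E n →ₗ[ℝ] ℝ)
  have hφ : φ w = 1 := by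
    have : φ w = (‖w‖ ^ 2)⁻¹ * inner ℝ w w := rfl
    rw [this, real_inner_self_eq_norm_sq, inv_mul_cancel₀ (by positivity)]
  let A : E n →ₗ[ℝ] E n := LinearMap.id + φ.smulRight (u - w)
  have hA : ∀ x, A x = x + φ x • (u - w) := fun x => rfl
  have hPA : ∀ x ∈ V, V.starProjection (A x) = x := by
    intro x hx
    rw [hA, map_add, map_smul, hPw, smul_zero, add_zero, Submodule.starProjection_eq_self_iff.mpr hx]
  have hinj : InjOn A W := fun x hx y hy h => by
    rw [← hPA x (hWV hx), h, hPA y (hWV hy)]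
  refine ⟨⟨W.map A, ?_⟩, ⟨w, hwW (Submodule.mem_span_singleton_self w), ?_⟩, ?_⟩
  · have := LinearMap.finrank_range_of_inj (f := A.domRestrict W) (injOn_iff_injective.mp hinj)
    rwa [LinearMap.range_domRestrict, hW] at this
  · rw [hA, hφ, one_smul, add_sub_cancel]
  · rw [Submodule.disjoint_def]
    rintro _ ⟨x, hx, rfl⟩ hAx
    rw [← Submodule.starProjection_apply_eq_zero_iff, hPA x (hWV hx)] at hAx
    rw [hAx, map_zero]

/-- For `y ∈ H`, the inner products of `y` with `v` and with the projection of `v` agree. So a `y ∈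
H` orthogonal to the image of `V` lies in `Vᗮ`. -/
theorem map_orthogonalProjectionOnto_eq_top {H V : Submodule ℝ (E n)} (h : Disjoint H Vᗮ) :
    V.map (H.orthogonalProjectionOnto : E n →ₗ[ℝ] H) = ⊤ := by
  rw [← Submodule.orthogonal_eq_bot_iff, Submodule.eq_bot_iff]
  intro y hy
  refine Subtype.ext ((Submodule.disjoint_def.mp h) y y.2 ?_)
  rw [Submodule.mem_orthogonal]
  intro v hv
  have := (Submodule.mem_orthogonal _ _).mp hy _ (Submodule.mem_map_of_mem hv)
  simpa using this

theorem interior_shadow_nonempty {K : ConvexBody (E n)} {H : Gr n j}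
    (h : Disjoint H.1 (affineSpan ℝ (K : Set (E n))).directionᗮ) :
    (interior (K.map H.1.orthogonalProjectionOnto : Set H.1)).Nonempty := by
  rw [(K.map H.1.orthogonalProjectionOnto).convex.interior_nonempty_iff_affineSpan_eq_top,
    ConvexBody.coe_map]
  have hmap : (affineSpan ℝ (K : Set (E n))).map
      (H.1.orthogonalProjectionOnto : E n →ₗ[ℝ] H.1).toAffineMap =
        affineSpan ℝ (H.1.orthogonalProjectionOnto '' (K : Set (E n))) :=
    AffineSubspace.map_span
      (H.1.orthogonalProjectionOnto : E n →ₗ[ℝ] H.1).toAffineMap (K : Set (E n))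
  have hne : (affineSpan ℝ
      (H.1.orthogonalProjectionOnto '' (K : Set (E n))) : Set H.1).Nonempty :=
    (K.nonempty.image _).mono (subset_affineSpan ℝ _)
  rw [← AffineSubspace.direction_eq_top_iff_of_nonempty hne, ← hmap, AffineSubspace.map_direction]
  exact map_orthogonalProjectionOnto_eq_top h

/-- A point outside a convex body is strictly separated from it by a vector outside a given proper
subspace. -/
theorem exists_separating_notMem {L : ConvexBody (E n)} {x : E n} (hx : x ∉ L)
    {S : Submodule ℝ (E n)} (hS : S ≠ ⊤) :
    ∃ u : E n, u ∉ S ∧ ∀ y ∈ L, inner ℝ u y < inner ℝ u x := by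
  obtain ⟨f, c, hf, hfx⟩ := geometric_hahn_banach_closed_point L.convex L.isClosed hx
  obtain ⟨v, rfl⟩ := (InnerProductSpace.toDual ℝ (E n)).surjective f
  simp only [InnerProductSpace.toDual_apply_apply] at hf hfx
  by_cases hv : v ∈ S
  swap
  · exact ⟨v, hv, fun y hy => (hf y hy).trans hfx⟩
  -- If `v ∈ S`, perturb it by `ε • z` with `z ∉ S`. Here `B` exceeds `inner z (y - x)` for all `y ∈
  -- L`, and `ε * B` is the separation gap, so strict separation survives.
  obtain ⟨z, hz⟩ : ∃ z, z ∉ S := by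
    by_contra! h
    exact hS (Submodule.eq_top_iff'.mpr h)
  obtain ⟨R, hR⟩ := L.isBounded.exists_norm_le
  set B : ℝ := ‖z‖ * (‖x‖ + R) + 1 with hB
  have hR0 : 0 ≤ R := by
    obtain ⟨y, hy⟩ := L.nonempty
    exact (norm_nonneg y).trans (hR y hy)
  have hB0 : 0 < B := by positivity
  set ε : ℝ := (inner ℝ v x - c) / B with hε
  have hε0 : 0 < ε := div_pos (sub_pos.mpr hfx) hB0
  have hεB : ε * B = inner ℝ v x - c := div_mul_cancel₀ _ hB0.ne'
  refine ⟨v + ε • z, fun h => hz ?_, fun y hy => ?_⟩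
  · have := S.smul_mem ε⁻¹ ((S.add_mem_iff_right hv).mp h)
    rwa [inv_smul_smul₀ hε0.ne'] at this
  · have h1 : inner ℝ z (y - x) ≤ ‖z‖ * (‖x‖ + R) :=
      (real_inner_le_norm _ _).trans (mul_le_mul_of_nonneg_left
        ((norm_sub_le _ _).trans (by linarith [hR y hy])) (norm_nonneg z))
    have h2 : ε * inner ℝ z (y - x) < ε * B := mul_lt_mul_of_pos_left (by linarith) hε0
    rw [inner_sub_right] at h2
    rw [inner_add_left, inner_add_left, real_inner_smul_left, real_inner_smul_left]
    linarith [hf y hy]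

theorem exists_shadowVol_pos (hj : 1 ≤ j) {K L : ConvexBody (E n)} (hK : j ≤ dim K) {x : E n}
    (hxK : x ∈ K) (hxL : x ∉ L) : ∃ H : Gr n j, 0 < shadowVol (K : Set (E n)) L H := by
  set V := (affineSpan ℝ (K : Set (E n))).direction with hV
  have hVtop : Vᗮ ≠ ⊤ := fun h => by
    rw [Submodule.orthogonal_eq_top_iff] at h
    have : dim K = 0 := by rw [dim, ← hV, h, finrank_bot]
    omega
  obtain ⟨u, hu, hsep⟩ := exists_separating_notMem hxL hVtop
  obtain ⟨H, huH, hH⟩ := Gr.exists_mem_disjoint_orthogonal hj hK hu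
  refine ⟨H, ?_⟩
  rw [shadowVol_eq]
  refine ConvexBody.measure_symmDiff_pos volume (interior_shadow_nonempty hH)
    (x := H.1.orthogonalProjectionOnto x) ⟨x, hxK, rfl⟩ ?_
  -- Since `u ∈ H`, the functional `inner u` factors through the projection onto `H`, so it would
  -- take equal values at `x` and `y`.
  rintro ⟨y, hy, hyx⟩
  have hin : ∀ z : E n, inner ℝ u z = inner ℝ (⟨u, huH⟩ : H.1) (H.1.orthogonalProjectionOnto z) :=
    fun z => by simp
  have h := hsep y hy
  rw [hin, hin x, hyx] at h
  exact lt_irrefl _ h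

theorem subset_of_delta_eq_zero (hj : 1 ≤ j) (h : j ≤ n) {K L : ConvexBody (E n)}
    (hK : j ≤ dim K) (h0 : delta h K L = 0) : (K : Set (E n)) ⊆ L := by
  intro x hxK
  by_contra hxL
  obtain ⟨H, hH⟩ := exists_shadowVol_pos hj hK hxK hxL
  have hpos : 0 < ∫ H : Gr n j, (shadowVol (K : Set (E n)) L H).toReal ∂(Gr.haar h) :=
    (continuous_shadowVol K L).integral_pos_of_hasCompactSupport_nonneg_nonzero
      (by
        have : CompactSpace (Gr n j) :=
          (Gr.isQuotientMap_rotate (Gr.coord h)).surjective.compactSpace (Gr.continuous_rotate _)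
        exact HasCompactSupport.of_compactSpace _)
      (fun _ => ENNReal.toReal_nonneg)
      (ENNReal.toReal_pos hH.ne' (shadowVol_lt_top K L H).ne).ne'
  exact (mul_pos (flagCoeff_pos h) hpos).ne' h0

theorem isMetricOn_delta (hj : 1 ≤ j) (h : j ≤ n) {k : ℕ} (hk : j ≤ k) :
    IsMetricOn (bodies n k) (delta h) where
  toIsPseudometricOn := isPseudometricOn_delta h _
  eq_of_eq_zero K hK L hL h0 := by
    refine ConvexBody.ext (Subset.antisymm (subset_of_delta_eq_zero hj h (hk.trans hK) h0)
      (subset_of_delta_eq_zero hj h (hk.trans hL) ?_))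
    rw [← h0]
    exact (isPseudometricOn_delta h univ).symm L (mem_univ _) K (mem_univ _)

/-! ### Failure of definiteness in dimension below `j` -/

/-- The unit ball of a subspace, as a convex body. -/
def unitBallIn (W : Submodule ℝ (E n)) : ConvexBody (E n) where
  carrier := Metric.closedBall 0 1 ∩ W
  convex' := (convex_closedBall 0 1).inter W.convex
  isCompact' := (isCompact_closedBall 0 1).inter_right W.closed_of_finiteDimensional
  nonempty' := ⟨0, by simp, W.zero_mem⟩

theorem mem_unitBallIn {W : Submodule ℝ (E n)} {x : E n} :
    x ∈ unitBallIn W ↔ ‖x‖ ≤ 1 ∧ x ∈ W :=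
  and_congr_left' mem_closedBall_zero_iff

theorem dim_unitBallIn (W : Submodule ℝ (E n)) : dim (unitBallIn W) = finrank ℝ W := by
  have h : vectorSpan ℝ (unitBallIn W : Set (E n)) = W := by
    refine le_antisymm (Submodule.span_le.mpr ?_) fun w hw => ?_
    · rintro _ ⟨x, hx, y, hy, rfl⟩
      exact W.sub_mem (mem_unitBallIn.mp hx).2 (mem_unitBallIn.mp hy).2
    · rcases eq_or_ne w 0 with rfl | hw0
      · exact Submodule.zero_mem _
      have hmem : ‖w‖⁻¹ • w ∈ unitBallIn W :=
        mem_unitBallIn.mpr ⟨by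
          rw [norm_smul, norm_inv, norm_norm, inv_mul_cancel₀ (norm_ne_zero_iff.mpr hw0)], W.smul_mem _ hw⟩
      have h0 : (0 : E n) ∈ unitBallIn W := mem_unitBallIn.mpr ⟨by simp, W.zero_mem⟩
      have h := (vectorSpan ℝ (unitBallIn W : Set (E n))).smul_mem ‖w‖
        (vsub_mem_vectorSpan ℝ hmem h0)
      rwa [vsub_eq_sub, sub_zero, smul_inv_smul₀ (norm_ne_zero_iff.mpr hw0)] at h
  rw [dim, direction_affineSpan, h]

theorem dim_rigidMotion_refl (x : E n) (K : ConvexBody (E n)) :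
    dim (rigidMotion (LinearIsometryEquiv.refl ℝ (E n)) x K) = dim K := by
  have h : (rigidMotion (LinearIsometryEquiv.refl ℝ (E n)) x K : Set (E n)) =
      x +ᵥ (K : Set (E n)) := image_congr fun y _ => add_comm _ _
  rw [dim, dim, direction_affineSpan, direction_affineSpan, h, vectorSpan_vadd]

theorem not_isMetricOn_delta (h : j ≤ n) {k : ℕ} (hk : k < j) :
    ¬ IsMetricOn (bodies n k) (delta h) := by
  intro hd
  obtain ⟨W, -, -, hW⟩ := Submodule.exists_between_finrank_eq (K := ℝ) (V := E n) (j := k)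
    (bot_le : ⊥ ≤ ⊤) (by simp) (by rw [finrank_top, finrank_euclideanSpace_fin]; omega)
  have : Nonempty (Fin n) := ⟨⟨0, by omega⟩⟩
  -- A translation by a vector of norm `2` takes the centre of the `k`-dimensional unit ball out of
  -- the ball, so the two bodies differ while both have dimension `k < j`.
  obtain ⟨v, hv⟩ := exists_norm_eq (E n) zero_le_two
  set K := unitBallIn W with hK
  set L := rigidMotion (LinearIsometryEquiv.refl ℝ (E n)) v K with hL
  have hdK : dim K = k := (dim_unitBallIn W).trans hW
  have hdL : dim L = k := (dim_rigidMotion_refl v K).trans hdK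
  have hKL : K = L := hd.eq_of_eq_zero K hdK.ge L hdL.ge
    (delta_eq_zero_of_dim_lt h (hdK.trans_lt hk) (hdL.trans_lt hk))
  have hvL : v ∈ L := ⟨0, mem_unitBallIn.mpr ⟨by simp, W.zero_mem⟩, by simp⟩
  rw [← hKL] at hvL
  have := (mem_unitBallIn.mp hvL).1
  linarith

end IntrinsicVolume

theorem theorem2p1 (n j : ℕ) (hj : 1 ≤ j) (hjn : j ≤ n) :
    -- `δ_j` is well defined, with values in `[0, ∞)`
    (∀ K L : ConvexBody (IntrinsicVolume.E n),
      (∀ H : IntrinsicVolume.Gr n j,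
        IntrinsicVolume.shadowVol (K : Set (IntrinsicVolume.E n)) L H < ⊤) ∧
      MeasureTheory.Integrable
        (fun H : IntrinsicVolume.Gr n j =>
          (IntrinsicVolume.shadowVol (K : Set (IntrinsicVolume.E n)) L H).toReal)
        (IntrinsicVolume.Gr.haar hjn) ∧
      0 ≤ IntrinsicVolume.delta hjn K L) ∧
    -- (i) a metric on bodies of dimension at least `k` if `k ≥ j`; only a pseudometric if `k < j`
    (∀ k : ℕ, j ≤ k →
      IntrinsicVolume.IsMetricOn (IntrinsicVolume.bodies n k) (IntrinsicVolume.delta hjn)) ∧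
    (∀ k : ℕ, k < j →
      IntrinsicVolume.IsPseudometricOn (IntrinsicVolume.bodies n k) (IntrinsicVolume.delta hjn) ∧
      ¬ IntrinsicVolume.IsMetricOn (IntrinsicVolume.bodies n k) (IntrinsicVolume.delta hjn)) ∧
    (∀ K L : ConvexBody (IntrinsicVolume.E n),
      IntrinsicVolume.dim K < j → IntrinsicVolume.dim L < j →
        IntrinsicVolume.delta hjn K L = 0) ∧
    -- (ii) continuous with respect to the Hausdorff metric
    (Continuous fun p : ConvexBody (IntrinsicVolume.E n) × ConvexBody (IntrinsicVolume.E n) =>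
      IntrinsicVolume.delta hjn p.1 p.2) ∧
    -- (iii) invariant under rigid motions
    (∀ (g : IntrinsicVolume.E n ≃ₗᵢ[ℝ] IntrinsicVolume.E n) (x : IntrinsicVolume.E n)
      (K L : ConvexBody (IntrinsicVolume.E n)),
      IntrinsicVolume.delta hjn (IntrinsicVolume.rigidMotion g x K)
          (IntrinsicVolume.rigidMotion g x L)
        = IntrinsicVolume.delta hjn K L) ∧
    -- (iv) positively `j`-homogeneous
    (∀ (t : ℝ), 0 < t → ∀ K L : ConvexBody (IntrinsicVolume.E n),
      IntrinsicVolume.delta hjn (t • K) (t • L) = t ^ j * IntrinsicVolume.delta hjn K L) := by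
  exact ⟨fun K L => ⟨IntrinsicVolume.shadowVol_lt_top K L,
      IntrinsicVolume.integrable_shadowVol hjn K L, IntrinsicVolume.delta_nonneg hjn K L⟩,
    fun _ hk => IntrinsicVolume.isMetricOn_delta hj hjn hk,
    fun _ hk => ⟨IntrinsicVolume.isPseudometricOn_delta hjn _,
      IntrinsicVolume.not_isMetricOn_delta hjn hk⟩,
    fun _ _ hK hL => IntrinsicVolume.delta_eq_zero_of_dim_lt hjn hK hL,
    IntrinsicVolume.continuous_delta hjn,
    IntrinsicVolume.delta_rigidMotion hjn,
    fun _ ht K L => IntrinsicVolume.delta_smul hjn ht K L⟩
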